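/- Let $M$ be a compact smooth manifold, let $\mathcal D\subset TM$ be a smooth bracket-generating distribution (a smooth subbundle of $TM$ such that smooth sections of $\mathcal D$ and their iterated Lie brackets span $T_xM$ at every $x$), and let $\langle\cdot,\cdot\rangle$ be a smooth inner product on $\mathcal D$ with norm $\|\cdot\|$. Let $L:\mathcal D\to\mathbb R$ be a $C^2$ function such that (i) for every $K\ge 0$ there is $C(K)\in\mathbb R$ with $L(v)\ge K\|v\|+C(K)$ for all $v\in\mathcal D$; (ii) for every $R\ge 0$, $\sup\{L(v):\|v\|\le R\}<+\infty$; (iii) there is $a>0$ with $\partial^2_{vv}L(v)(w,w)\ge a$ for all $x \in M$ and $v,w\in\mathcal D_x$ with $\|w\|=1$, where $\partial_v$ denotes the derivative along the fibres. The energy is $E(v)=\partial_vL(v)\cdot v-L(v)$. A continuous curve $\gamma:[a,b]\to M$ is absolutely continuous if $\varphi\circ\gamma$ is absolutely continuous for every smooth compactly supported $\varphi:M\to\mathbb R$, and horizontal if moreover $\dot\gamma(t)$ exists and belongs to $\mathcal D$ for a.e. $t\in[a,b]$. For such $\gamma$ and $k\in\mathbb R$ put $A_{L+k}(\gamma)=\int_a^b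 (L(\dot\gamma(t))+k)\,dt\in\mathbb R\cup\{+\infty\}$. Let $c=c(L)$ be the critical value, i.e. the infimum of all $k\in\mathbb R$ for which there is a function $u:M\to\mathbb R$ with $u(\gamma(b))-u(\gamma(a))\le A_{L+k}(\gamma)$ for all $a<b$ and all horizontal absolutely continuous $\gamma:[a,b]\to M$. For $x,y\in M$ and $t>0$ let $h_t(x,y)$ be the infimum of $A_L(\gamma)$ over all horizontal absolutely continuous $\gamma:[0,t]\to M$ with $\gamma(0)=x$, $\gamma(t)=y$, and let $\Phi(x,y)=\inf_{t>0}(h_t(x,y)+ct)$. A horizontal absolutely continuous curve $\gamma:[a,b]\to M$, $a<b$, is semi-static if $A_{L+c}(\gamma)$ and $\Phi(\gamma(a),\gamma(b))$ are finite and equal; a curve defined on an arbitrary interval $J\subset\mathbb R$ is semi-static if its restriction to every compact subinterval $[s,t]\subset J$, $s<t$, is a semi-static horizontal absolutely continuous curve. Then semi-static curves have constant energy $c(L)$: if $\eta:[a,b]\to M$ is semi-static, or if $J$ is any interval and $\eta:J\to M$ is semi-static, then for almost every $t$ in $[a,b]$, respectively in $J$, the velocity $\dot\eta(t)\in\mathcal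 D$ exists and $$E(\dot\eta(t))=\partial_vL(\dot\eta(t))\cdot\dot\eta(t)-L(\dot\eta(t))=c(L).$$ -/

import Mathlib

open Bundle Manifold MeasureTheory Set
open scoped ContDiff Topology

noncomputable section

namespace SubRiemannian

section Structure

variable (E : Type*) [NormedAddCommGroup E] [NormedSpace ℝ E]
  (M : Type*) [TopologicalSpace M] [ChartedSpace E M] [IsManifold 𝓘(ℝ, E) ∞ M]
  (F : Type*) [NormedAddCommGroup F] [NormedSpace ℝ F]
  (D : M → Type*) [TopologicalSpace (TotalSpace F D)] [∀ x, NormedAddCommGroup (D x)]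
  [∀ x, InnerProductSpace ℝ (D x)] [FiberBundle F D] [VectorBundle ℝ F D]

/-- A (constant rank) distribution on the manifold `M`: a vector bundle `D` over `M` realised as a
smooth vector subbundle of the tangent bundle, through a smooth injective vector bundle morphism
`D → TM` covering the identity. The sub-Riemannian metric is the inner product on the fibres
`D x`, its smoothness being the class `IsContMDiffRiemannianBundle`. -/
structure Distribution where
  /-- The inclusion of the fibre `D x` in the tangent space at `x`. -/
  incl : ∀ x : M, D x →L[ℝ] TangentSpace 𝓘(ℝ, E) x
  injective_incl : ∀ x, Function.Injective (incl x)
  contMDiff_incl : ContMDiff (𝓘(ℝ, E).prod 𝓘(ℝ, F)) 𝓘(ℝ, E).tangent ∞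
    (fun v : TotalSpace F D => (⟨v.proj, incl v.proj v.2⟩ : TangentBundle 𝓘(ℝ, E) M))

end Structure

variable {E : Type*} [NormedAddCommGroup E] [NormedSpace ℝ E]
  {M : Type*} [TopologicalSpace M] [ChartedSpace E M] [IsManifold 𝓘(ℝ, E) ∞ M]
  {F : Type*} [NormedAddCommGroup F] [NormedSpace ℝ F]
  {D : M → Type*} [TopologicalSpace (TotalSpace F D)] [∀ x, NormedAddCommGroup (D x)]
  [∀ x, InnerProductSpace ℝ (D x)] [FiberBundle F D] [VectorBundle ℝ F D]

/-- The vector fields obtained from smooth sections of the distribution by iterated Lie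
brackets. -/
inductive IsIteratedBracket (𝒟 : Distribution E M F D) :
    (∀ x : M, TangentSpace 𝓘(ℝ, E) x) → Prop
  | horizontal (σ : ∀ x : M, D x)
      (hσ : ContMDiff 𝓘(ℝ, E) (𝓘(ℝ, E).prod 𝓘(ℝ, F)) ∞ (fun x => TotalSpace.mk' F x (σ x))) :
      IsIteratedBracket 𝒟 (fun x => 𝒟.incl x (σ x))
  | bracket (V W : ∀ x : M, TangentSpace 𝓘(ℝ, E) x)
      (hV : IsIteratedBracket 𝒟 V) (hW : IsIteratedBracket 𝒟 W) :
      IsIteratedBracket 𝒟 (VectorField.mlieBracket 𝓘(ℝ, E) V W)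

/-- The distribution is bracket generating: at every point, horizontal fields and their iterated
brackets span the tangent space. -/
def IsBracketGenerating (𝒟 : Distribution E M F D) : Prop :=
  ∀ x : M, Submodule.span ℝ
    {v : TangentSpace 𝓘(ℝ, E) x | ∃ V, IsIteratedBracket 𝒟 V ∧ V x = v} = ⊤

/-- The standing assumptions on a Lagrangian `L : D → ℝ`: class `C²`, uniform superlinearity,
uniform boundedness, and uniform strict convexity along the fibres. -/
structure IsTonelli (E : Type*) [NormedAddCommGroup E] [NormedSpace ℝ E]
    {M : Type*} [TopologicalSpace M] [ChartedSpace E M] [IsManifold 𝓘(ℝ, E) ∞ M]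
    {F : Type*} [NormedAddCommGroup F] [NormedSpace ℝ F]
    {D : M → Type*} [TopologicalSpace (TotalSpace F D)] [∀ x, NormedAddCommGroup (D x)]
    [∀ x, InnerProductSpace ℝ (D x)] [FiberBundle F D] [VectorBundle ℝ F D]
    (L : TotalSpace F D → ℝ) : Prop where
  contMDiff : ContMDiff (𝓘(ℝ, E).prod 𝓘(ℝ, F)) 𝓘(ℝ, ℝ) 2 L
  superlinear : ∀ K : ℝ, 0 ≤ K → ∃ C : ℝ, ∀ v : TotalSpace F D, K * ‖v.2‖ + C ≤ L v
  bounded : ∀ R : ℝ, 0 ≤ R → BddAbove (L '' {v : TotalSpace F D | ‖v.2‖ ≤ R})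
  convex : ∃ a : ℝ, 0 < a ∧ ∀ (x : M) (v w : D x), ‖w‖ = 1 →
    a ≤ iteratedFDeriv ℝ 2 (fun u : D x => L ⟨x, u⟩) v ![w, w]

/-- The energy `E(v) = ∂ᵥL(v)·v - L(v)`, with `∂ᵥ` the derivative along the fibre. -/
def energy (L : TotalSpace F D → ℝ) (v : TotalSpace F D) : ℝ :=
  fderiv ℝ (fun u : D v.proj => L ⟨v.proj, u⟩) v.2 v.2 - L v

/-- `γ` is differentiable at `t`, with velocity the horizontal vector `v`. -/
def HasHorizontalVelocityAt (𝒟 : Distribution E M F D) (γ : ℝ → M) (t : ℝ) (v : D (γ t)) : Prop :=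
  HasMFDerivAt 𝓘(ℝ, ℝ) 𝓘(ℝ, E) γ t ((1 : ℝ →L[ℝ] ℝ).smulRight (𝒟.incl (γ t) v))

open Classical in
/-- The velocity of `γ` at `t` as an element of the distribution (the zero vector where `γ` has no
horizontal velocity, which for horizontal curves is a null set of times). -/
def velocity (𝒟 : Distribution E M F D) (γ : ℝ → M) (t : ℝ) : TotalSpace F D :=
  ⟨γ t, if h : ∃ v, HasHorizontalVelocityAt 𝒟 γ t v then h.choose else 0⟩

variable (E) in
/-- `γ : [a, b] → M` is absolutely continuous: it is continuous, and `φ ∘ γ` is absolutely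
continuous for every smooth compactly supported `φ : M → ℝ`. -/
def IsAbsolutelyContinuous (γ : ℝ → M) (a b : ℝ) : Prop :=
  ContinuousOn γ (Icc a b) ∧
  ∀ φ : M → ℝ, ContMDiff 𝓘(ℝ, E) 𝓘(ℝ, ℝ) ∞ φ → HasCompactSupport φ →
    AbsolutelyContinuousOnInterval (φ ∘ γ) a b

/-- `γ` restricts to a horizontal absolutely continuous curve on `[a, b]`. Curves are represented
by total functions `ℝ → M`, of which only the restriction to `[a, b]` matters. -/
def IsHorizontal (𝒟 : Distribution E M F D) (γ : ℝ → M) (a b : ℝ) : Prop :=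
  IsAbsolutelyContinuous E γ a b ∧
  ∀ᵐ t ∂(volume.restrict (Icc a b)), ∃ v, HasHorizontalVelocityAt 𝒟 γ t v

open Classical in
/-- The action `A_L(γ) = ∫ₐᵇ L(γ̇(t)) dt ∈ ℝ ∪ {+∞}`. A Tonelli Lagrangian is bounded below, so
that the integral is either convergent or equal to `+∞`. -/
def action (𝒟 : Distribution E M F D) (L : TotalSpace F D → ℝ) (γ : ℝ → M) (a b : ℝ) : EReal :=
  if IntegrableOn (fun t => L (velocity 𝒟 γ t)) (Icc a b) then
    ((∫ t in Icc a b, L (velocity 𝒟 γ t) : ℝ) : EReal)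
  else ⊤

/-- `u : M → ℝ` is `L + c` dominated. -/
def IsDominated (𝒟 : Distribution E M F D) (L : TotalSpace F D → ℝ) (c : ℝ) (u : M → ℝ) : Prop :=
  ∀ (a b : ℝ) (γ : ℝ → M), a < b → IsHorizontal 𝒟 γ a b →
    ((u (γ b) - u (γ a) : ℝ) : EReal) ≤ action 𝒟 (fun v => L v + c) γ a b

/-- The critical value `c(L)`. -/
def criticalValue (𝒟 : Distribution E M F D) (L : TotalSpace F D → ℝ) : ℝ :=
  sInf {c : ℝ | ∃ u : M → ℝ, IsDominated 𝒟 L c u}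

/-- The minimal action `h_t(x, y)` (with value `+∞` if no curve of finite action joins `x` to `y`
in time `t`). -/
def minimalAction (𝒟 : Distribution E M F D) (L : TotalSpace F D → ℝ) (t : ℝ) (x y : M) : EReal :=
  sInf {r : EReal | ∃ γ : ℝ → M, IsHorizontal 𝒟 γ 0 t ∧ γ 0 = x ∧ γ t = y ∧ r = action 𝒟 L γ 0 t}

/-- The Mañé potential `Φ(x, y) = inf_{t > 0} (h_t(x, y) + c t)`, with `c = c(L)`. -/
def manePotential (𝒟 : Distribution E M F D) (L : TotalSpace F D → ℝ) (x y : M) : EReal :=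
  sInf {r : EReal | ∃ t : ℝ, 0 < t ∧
    r = minimalAction 𝒟 L t x y + ((criticalValue 𝒟 L * t : ℝ) : EReal)}

/-- The horizontal curve `γ : [a, b] → M` is semi-static: `A_{L + c}(γ) = Φ(γ(a), γ(b))` as real
numbers, with `c = c(L)`. -/
def IsSemiStatic (𝒟 : Distribution E M F D) (L : TotalSpace F D → ℝ) (γ : ℝ → M) (a b : ℝ) : Prop :=
  IsHorizontal 𝒟 γ a b ∧
  ∃ r : ℝ, action 𝒟 (fun v => L v + criticalValue 𝒟 L) γ a b = (r : EReal) ∧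
    manePotential 𝒟 L (γ a) (γ b) = (r : EReal)

/-- A horizontal curve on an arbitrary interval `J` is semi-static if its restriction to every
nondegenerate compact subinterval is. -/
def IsSemiStaticOn (𝒟 : Distribution E M F D) (L : TotalSpace F D → ℝ) (γ : ℝ → M)
    (J : Set ℝ) : Prop :=
  ∀ a ∈ J, ∀ b ∈ J, a < b → IsSemiStatic 𝒟 L γ a b

end SubRiemannian

end

/-! The potential `Φ` is an infimum over all durations, so a semi-static curve also minimises
`A_{L+c}` among its own time changes. If `τ' = h`, with `h` measurable and pinched between positive
constants, then `γ ∘ τ⁻¹` has velocity `γ̇ / h`, and a change of variables turns minimality into `∫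
(L(γ̇) + c) ≤ ∫ h (L(γ̇ / h) + c)` (`IsSemiStatic.integral_le`).

Take `h = β` on the set of times where `β (L(γ̇ / β) + c) < L(γ̇) + c`, and `h = 1` elsewhere: the
inequality forces this set to be null (`IsSemiStatic.ae_le`). Hence at almost every time `β ↦ β
(L(γ̇ / β) + c)` is minimal at `β = 1`, first over positive rationals and then, by continuity, over
all `β > 0`. Its derivative at `1` is `L(γ̇) + c - ∂ᵥL(γ̇)·γ̇`, which vanishes exactly when the
energy is `c` (`fderiv_apply_self_sub_eq`).

The choice of `h` requires `L(γ̇ / β)` to be measurable in time, which is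
`IsHorizontal.aestronglyMeasurable`. -/

noncomputable section

namespace SubRiemannian

/-! ### Bi-Lipschitz changes of time on the real line. -/

section RealAnalysis

open scoped NNReal

/-- An increasing bijection keeps disjoint intervals disjoint, and the Lipschitz bound controls
their total length. -/
lemma absolutelyContinuousOnInterval_comp_orderIso {X : Type*} [PseudoMetricSpace X] {f : ℝ → X}
    {a b : ℝ} {K : ℝ≥0} (σ : ℝ ≃o ℝ) (hσ : LipschitzWith K σ)
    (hf : AbsolutelyContinuousOnInterval f (σ a) (σ b)) :
    AbsolutelyContinuousOnInterval (f ∘ σ) a b := by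
  rw [absolutelyContinuousOnInterval_iff] at hf ⊢
  intro ε hε
  obtain ⟨δ, hδ, H⟩ := hf ε hε
  -- `K + 1` instead of `K` avoids dividing by zero.
  refine ⟨δ / (K + 1), by positivity, fun I hI hlen => ?_⟩
  refine H (I.1, fun i => (σ (I.2 i).1, σ (I.2 i).2)) ⟨fun i hi => ?_, ?_⟩ ?_
  · have := hI.1 i hi
    simp only [mem_uIcc, map_le_map_iff] at this ⊢
    exact this
  · intro i hi j hj hij
    refine Set.disjoint_left.2 fun z hz hz' => ?_
    have hd : Disjoint (uIoc (I.2 i).1 (I.2 i).2) (uIoc (I.2 j).1 (I.2 j).2) := hI.2 hi hj hij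
    refine Set.disjoint_left.1 hd (?_ : σ.symm z ∈ _) ?_
    · simpa only [mem_uIoc, ← σ.lt_symm_apply, ← σ.symm_apply_le] using hz
    · simpa only [mem_uIoc, ← σ.lt_symm_apply, ← σ.symm_apply_le] using hz'
  · calc ∑ i ∈ Finset.range I.1, dist (σ (I.2 i).1) (σ (I.2 i).2)
        ≤ ∑ i ∈ Finset.range I.1, (K + 1) * dist (I.2 i).1 (I.2 i).2 := by
          refine Finset.sum_le_sum fun i _ => (hσ.dist_le_mul _ _).trans ?_
          gcongr
          simp
      _ = (K + 1) * ∑ i ∈ Finset.range I.1, dist (I.2 i).1 (I.2 i).2 := by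
          rw [Finset.mul_sum]
      _ < δ := by rwa [lt_div_iff₀' (by positivity)] at hlen

/-- Lebesgue measure on the line is one-dimensional Hausdorff measure, which a Lipschitz map
multiplies by at most `K`. -/
lemma volume_image_eq_zero_of_lipschitzWith {f : ℝ → ℝ} {K : ℝ≥0} (hf : LipschitzWith K f)
    {s : Set ℝ} (hs : volume s = 0) : volume (f '' s) = 0 := by
  have h := hf.hausdorffMeasure_image_le zero_le_one s
  rw [hausdorffMeasure_real, hs, mul_zero] at h
  exact le_antisymm h bot_le

lemma ae_comp_symm {τ : ℝ ≃o ℝ} {K : ℝ≥0} (hτ : LipschitzWith K τ) {p : ℝ → Prop}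
    (hp : ∀ᵐ s, p s) : ∀ᵐ u, p (τ.symm u) := by
  refine measure_mono_null ?_ (volume_image_eq_zero_of_lipschitzWith hτ (ae_iff.1 hp))
  intro u hu
  exact ⟨τ.symm u, hu, τ.apply_symm_apply u⟩

/-- `τ` is the primitive of `h` vanishing at `a`. The upper bound on `h` makes it Lipschitz, the
lower bound makes it onto with Lipschitz inverse, and Lebesgue differentiation gives the derivative.
-/
lemma exists_orderIso_hasDerivAt {h : ℝ → ℝ} (hh : Measurable h) {m K : ℝ≥0} (hm : 0 < m)
    (hmh : ∀ s, m ≤ h s) (hhK : ∀ s, h s ≤ K) (a : ℝ) :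
    ∃ τ : ℝ ≃o ℝ, τ a = 0 ∧ LipschitzWith K τ ∧ LipschitzWith m⁻¹ τ.symm ∧
      ∀ᵐ s, HasDerivAt τ (h s) s := by
  have hloc : LocallyIntegrable h volume := by
    refine (locallyIntegrable_const (K : ℝ)).mono hh.aestronglyMeasurable (.of_forall fun s => ?_)
    rw [Real.norm_of_nonneg (m.2.trans (hmh s)), Real.norm_of_nonneg (by positivity)]
    exact hhK s
  have hint (x y : ℝ) : IntervalIntegrable h volume x y :=
    intervalIntegrable_iff.mpr <|
      (hloc.integrableOn_isCompact isCompact_uIcc).mono_set uIoc_subset_uIcc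
  let T : ℝ → ℝ := fun s => ∫ t in a..s, h t
  have hsub (x y : ℝ) : T y - T x = ∫ t in x..y, h t :=
    intervalIntegral.integral_interval_sub_left (hint _ _) (hint _ _)
  have hlow (x y : ℝ) (hxy : x ≤ y) : m * (y - x) ≤ T y - T x := by
    rw [hsub]
    have := intervalIntegral.integral_mono_on hxy (intervalIntegrable_const (c := (m : ℝ)))
      (hint x y) (fun s _ => hmh s)
    simpa [mul_comm] using this
  have hup (x y : ℝ) (hxy : x ≤ y) : T y - T x ≤ K * (y - x) := by
    rw [hsub]
    have := intervalIntegral.integral_mono_on hxy (hint x y)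
      (intervalIntegrable_const (c := (K : ℝ))) (fun s _ => hhK s)
    simpa [mul_comm] using this
  have hm' : (0 : ℝ) < m := hm
  have hmono : StrictMono T := fun x y hxy => by
    have := hlow x y hxy.le
    have := mul_pos hm' (sub_pos.2 hxy)
    linarith
  have hLip : LipschitzWith K T := by
    refine LipschitzWith.of_le_add_mul K fun x y => ?_
    rcases le_total x y with hxy | hxy
    · have := hmono.monotone hxy
      have : (0 : ℝ) ≤ K * dist x y := by positivity
      linarith
    · have := hup y x hxy
      rw [Real.dist_eq, abs_of_nonneg (sub_nonneg.2 hxy)]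
      linarith
  have ha : T a = 0 := intervalIntegral.integral_same
  have hsurj : Function.Surjective T := by
    refine hLip.continuous.surjective ?_ ?_
    · refine Filter.tendsto_atTop_mono' _ (f₁ := fun s => m * (s - a)) ?_
        ((Filter.tendsto_atTop_add_const_right _ (-a) Filter.tendsto_id).const_mul_atTop hm')
      filter_upwards [Filter.eventually_ge_atTop a] with s hs
      have := hlow a s hs
      rwa [ha, sub_zero] at this
    · refine Filter.tendsto_atBot_mono' _ (f₁ := fun s => m * (s - a)) ?_
        ((Filter.tendsto_atBot_add_const_right _ (-a) Filter.tendsto_id).const_mul_atBot hm')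
      filter_upwards [Filter.eventually_le_atBot a] with s hs
      have := hlow s a hs
      rw [ha] at this
      linarith
  refine ⟨hmono.orderIsoOfSurjective T hsurj, ha, hLip, ?_, ?_⟩
  · set τ := hmono.orderIsoOfSurjective T hsurj with hτ
    have hT : ∀ u, T (τ.symm u) = u := fun u => τ.apply_symm_apply u
    refine LipschitzWith.of_le_add_mul _ fun x y => ?_
    rcases le_total x y with hxy | hxy
    · have := τ.symm.monotone hxy
      have : (0 : ℝ) ≤ (m⁻¹ : ℝ≥0) * dist x y := by positivity
      linarith
    · have := hlow _ _ (τ.symm.monotone hxy)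
      rw [hT, hT, ← le_div_iff₀' hm'] at this
      rw [Real.dist_eq, abs_of_nonneg (sub_nonneg.2 hxy), NNReal.coe_inv, ← div_eq_inv_mul]
      linarith
  · filter_upwards [LocallyIntegrable.ae_hasDerivAt_integral hloc] with s hs
    exact hs a

/-- Change of variables along a bi-Lipschitz reparametrisation. -/
lemma change_of_variables {τ : ℝ ≃o ℝ} {K : ℝ≥0} (hτ : LipschitzWith K τ) {h : ℝ → ℝ}
    (hpos : ∀ s, 0 < h s) (hd : ∀ᵐ s, HasDerivAt τ (h s) s) (a b : ℝ) (g : ℝ → ℝ) :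
    (IntegrableOn g (Icc (τ a) (τ b)) ↔ IntegrableOn (fun s => h s * g (τ s)) (Icc a b)) ∧
      ∫ u in Icc (τ a) (τ b), g u = ∫ s in Icc a b, h s * g (τ s) := by
  -- The area formula needs a derivative at every point, so a measurable null set is removed; its
  -- image is null because `τ` is Lipschitz.
  obtain ⟨N, hN, hNm, hN0⟩ := exists_measurable_superset_of_null (ae_iff.1 hd)
  have hder : ∀ s ∈ Icc a b \ N, HasDerivWithinAt τ (h s) (Icc a b \ N) s := fun s hs =>
    (not_not.1 fun H => hs.2 (hN H) : HasDerivAt τ (h s) s).hasDerivWithinAt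
  have hmeas : MeasurableSet (Icc a b \ N) := measurableSet_Icc.diff hNm
  have e1 : (Icc a b \ N : Set ℝ) =ᵐ[volume] Icc a b := sdiff_null_ae_eq_self hN0
  have e2 : (τ '' (Icc a b \ N) : Set ℝ) =ᵐ[volume] Icc (τ a) (τ b) := by
    rw [image_sdiff τ.injective, OrderIso.image_Icc]
    exact sdiff_null_ae_eq_self (volume_image_eq_zero_of_lipschitzWith hτ hN0)
  have habs : (fun s => |h s| • g (τ s)) = fun s => h s * g (τ s) := by
    ext s
    rw [abs_of_pos (hpos s), smul_eq_mul]
  have i1 := integrableOn_image_iff_integrableOn_abs_deriv_smul hmeas hder τ.injective.injOn g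
  have i2 := integral_image_eq_integral_abs_deriv_smul hmeas hder τ.injective.injOn g
  rw [habs, integrableOn_congr_set_ae e1, integrableOn_congr_set_ae e2] at i1
  rw [habs, setIntegral_congr_set e1, setIntegral_congr_set e2] at i2
  exact ⟨i1, i2⟩

end RealAnalysis

/-! ### Horizontal curves and their action under a change of time. -/

section Reparametrisation

open scoped NNReal

set_option linter.unusedSectionVars false

variable {E : Type*} [NormedAddCommGroup E] [NormedSpace ℝ E]
  {M : Type*} [TopologicalSpace M] [ChartedSpace E M] [IsManifold 𝓘(ℝ, E) ∞ M]
  {F : Type*} [NormedAddCommGroup F] [NormedSpace ℝ F]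
  {D : M → Type*} [TopologicalSpace (TotalSpace F D)] [∀ x, NormedAddCommGroup (D x)]
  [∀ x, InnerProductSpace ℝ (D x)] [FiberBundle F D] [VectorBundle ℝ F D]
  {𝒟 : Distribution E M F D} {γ : ℝ → M}

/-- Multiplication by `r` in the fibres of a vector bundle. -/
def fibreSmul (r : ℝ) (p : TotalSpace F D) : TotalSpace F D := ⟨p.1, r • p.2⟩

@[simp] lemma fibreSmul_one (p : TotalSpace F D) : fibreSmul 1 p = p := by
  simp [fibreSmul]

/-- Injectivity of the inclusion makes the choice in `velocity` harmless. -/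
lemma HasHorizontalVelocityAt.unique {t : ℝ} {v w : D (γ t)}
    (hv : HasHorizontalVelocityAt 𝒟 γ t v) (hw : HasHorizontalVelocityAt 𝒟 γ t w) : v = w := by
  have h : (1 : ℝ) • 𝒟.incl (γ t) v = (1 : ℝ) • 𝒟.incl (γ t) w :=
    congrArg (fun A : ℝ →L[ℝ] E => A 1) (hasMFDerivAt_unique hv hw)
  rw [one_smul, one_smul] at h
  exact 𝒟.injective_incl _ h

lemma HasHorizontalVelocityAt.velocity_eq {t : ℝ} {v : D (γ t)}
    (hv : HasHorizontalVelocityAt 𝒟 γ t v) : velocity 𝒟 γ t = ⟨γ t, v⟩ := by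
  have h : ∃ w, HasHorizontalVelocityAt 𝒟 γ t w := ⟨v, hv⟩
  rw [velocity, dif_pos h, h.choose_spec.unique hv]

lemma HasHorizontalVelocityAt.comp {σ : ℝ → ℝ} {u k : ℝ} {v : D (γ (σ u))}
    (hv : HasHorizontalVelocityAt 𝒟 γ (σ u) v) (hσ : HasDerivAt σ k u) :
    HasHorizontalVelocityAt 𝒟 (γ ∘ σ) u (k • v : D (γ (σ u))) := by
  have h := HasMFDerivAt.comp u hv hσ.hasFDerivAt.hasMFDerivAt
  refine h.congr_mfderiv (ContinuousLinearMap.ext fun (x : ℝ) => ?_)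
  change (x • k) • 𝒟.incl (γ (σ u)) v = x • 𝒟.incl (γ (σ u)) (k • v)
  rw [map_smul, smul_assoc]

lemma HasDerivAt.orderIso_symm {τ : ℝ ≃o ℝ} {u k : ℝ} (h : HasDerivAt τ k (τ.symm u))
    (hk : k ≠ 0) : HasDerivAt τ.symm k⁻¹ u :=
  h.of_local_left_inverse τ.symm.continuous.continuousAt hk (.of_forall τ.apply_symm_apply)

variable {a b : ℝ} {τ : ℝ ≃o ℝ} {K K' : ℝ≥0} {h : ℝ → ℝ}

lemma IsHorizontal.ae_comp_symm (hγ : IsHorizontal 𝒟 γ a b) (hτ : LipschitzWith K τ)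
    (hpos : ∀ s, 0 < h s) (hd : ∀ᵐ s, HasDerivAt τ (h s) s) :
    ∀ᵐ u, u ∈ Icc (τ a) (τ b) → ∃ v, HasHorizontalVelocityAt 𝒟 γ (τ.symm u) v ∧
      HasHorizontalVelocityAt 𝒟 (γ ∘ τ.symm) u ((h (τ.symm u))⁻¹ • v : D (γ (τ.symm u))) := by
  have h1 := SubRiemannian.ae_comp_symm hτ ((ae_restrict_iff' measurableSet_Icc).1 hγ.2)
  have h2 := SubRiemannian.ae_comp_symm hτ hd
  filter_upwards [h1, h2] with u h1 h2 hu
  obtain ⟨v, hv⟩ := h1 ⟨τ.le_symm_apply.2 hu.1, τ.symm_apply_le.2 hu.2⟩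
  exact ⟨v, hv, hv.comp (HasDerivAt.orderIso_symm h2 (hpos _).ne')⟩

/-- Both Lipschitz bounds matter: that of `τ.symm` preserves absolute continuity, that of `τ`
carries exceptional null sets of times to null sets. -/
lemma IsHorizontal.comp_symm (hγ : IsHorizontal 𝒟 γ a b) (hτ : LipschitzWith K τ)
    (hτ' : LipschitzWith K' τ.symm) (hpos : ∀ s, 0 < h s) (hd : ∀ᵐ s, HasDerivAt τ (h s) s) :
    IsHorizontal 𝒟 (γ ∘ τ.symm) (τ a) (τ b) := by
  refine ⟨⟨?_, fun φ hφ hc => ?_⟩, ?_⟩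
  · exact ContinuousOn.comp hγ.1.1 τ.symm.continuous.continuousOn fun u hu =>
      ⟨τ.le_symm_apply.2 hu.1, τ.symm_apply_le.2 hu.2⟩
  · refine absolutelyContinuousOnInterval_comp_orderIso (f := φ ∘ γ) τ.symm hτ' ?_
    rw [τ.symm_apply_apply, τ.symm_apply_apply]
    exact hγ.1.2 φ hφ hc
  · rw [ae_restrict_iff' measurableSet_Icc]
    filter_upwards [hγ.ae_comp_symm hτ hpos hd] with u hu hm
    obtain ⟨v, -, hv⟩ := hu hm
    exact ⟨_, hv⟩

/-- The action of a curve reparametrised by a bi-Lipschitz change of time `τ`. -/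
lemma IsHorizontal.action_comp_symm (hγ : IsHorizontal 𝒟 γ a b) (hτ : LipschitzWith K τ)
    (hpos : ∀ s, 0 < h s) (hd : ∀ᵐ s, HasDerivAt τ (h s) s) (L : TotalSpace F D → ℝ)
    (hint : IntegrableOn (fun s => h s * L (fibreSmul (h s)⁻¹ (velocity 𝒟 γ s))) (Icc a b)) :
    action 𝒟 L (γ ∘ τ.symm) (τ a) (τ b) =
      ((∫ s in Icc a b, h s * L (fibreSmul (h s)⁻¹ (velocity 𝒟 γ s)) : ℝ) : EReal) := by
  let g : ℝ → ℝ := fun u => L (fibreSmul (h (τ.symm u))⁻¹ (velocity 𝒟 γ (τ.symm u)))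
  have hg : (fun u => L (velocity 𝒟 (γ ∘ τ.symm) u))
      =ᵐ[volume.restrict (Icc (τ a) (τ b))] g := by
    rw [Filter.EventuallyEq, ae_restrict_iff' measurableSet_Icc]
    filter_upwards [hγ.ae_comp_symm hτ hpos hd] with u hu hm
    obtain ⟨v, hv, hv'⟩ := hu hm
    simp only [g]
    rw [hv.velocity_eq, hv'.velocity_eq]
    rfl
  obtain ⟨h1, h2⟩ := change_of_variables hτ hpos hd a b g
  simp only [g, OrderIso.symm_apply_apply] at h1 h2
  have h3 : IntegrableOn (fun u => L (velocity 𝒟 (γ ∘ τ.symm) u)) (Icc (τ a) (τ b)) :=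
    (h1.2 hint).congr hg.symm
  rw [action, if_pos h3, integral_congr_ae hg, h2]

/-- The action of a semi-static curve does not decrease under bi-Lipschitz changes of time. -/
lemma IsSemiStatic.integral_le {L : TotalSpace F D → ℝ} (hγ : IsSemiStatic 𝒟 L γ a b)
    (hab : a < b) (hτ : LipschitzWith K τ) (hτ' : LipschitzWith K' τ.symm) (hτa : τ a = 0)
    (hpos : ∀ s, 0 < h s) (hd : ∀ᵐ s, HasDerivAt τ (h s) s) (hh : IntegrableOn h (Icc a b))
    (hint : IntegrableOn (fun s => h s * L (fibreSmul (h s)⁻¹ (velocity 𝒟 γ s))) (Icc a b)) :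
    ∫ s in Icc a b, (L (velocity 𝒟 γ s) + criticalValue 𝒟 L) ≤
      ∫ s in Icc a b, h s * (L (fibreSmul (h s)⁻¹ (velocity 𝒟 γ s)) + criticalValue 𝒟 L) := by
  obtain ⟨hor, r, hr, hΦ⟩ := hγ
  have hr' : ∫ s in Icc a b, (L (velocity 𝒟 γ s) + criticalValue 𝒟 L) = r := by
    rw [action] at hr
    split_ifs at hr with hi
    · exact_mod_cast hr
    · exact absurd hr (EReal.top_ne_coe r)
  -- The new duration, from the change of variables applied to the constant `1`.
  have hlen : τ b = ∫ s in Icc a b, h s := by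
    have := (change_of_variables hτ hpos hd a b (fun _ => 1)).2
    simpa [hτa, (hτa ▸ τ.monotone hab.le : 0 ≤ τ b)] using this
  have hle : manePotential 𝒟 L (γ a) (γ b) ≤ action 𝒟 L (γ ∘ τ.symm) (τ a) (τ b) +
      ((criticalValue 𝒟 L * τ b : ℝ) : EReal) := by
    have h1 : manePotential 𝒟 L (γ a) (γ b) ≤ minimalAction 𝒟 L (τ b) (γ a) (γ b) +
        ((criticalValue 𝒟 L * τ b : ℝ) : EReal) :=
      sInf_le ⟨τ b, hτa ▸ τ.strictMono hab, rfl⟩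
    have h2 : minimalAction 𝒟 L (τ b) (γ a) (γ b) ≤ action 𝒟 L (γ ∘ τ.symm) (τ a) (τ b) := by
      refine sInf_le ⟨γ ∘ τ.symm, ?_, ?_, ?_, ?_⟩
      · exact hτa ▸ hor.comp_symm hτ hτ' hpos hd
      · simp [← hτa]
      · simp
      · rw [hτa]
    exact h1.trans (add_le_add_left h2 _)
  rw [hΦ, hor.action_comp_symm hτ hpos hd L hint, ← EReal.coe_add, EReal.coe_le_coe_iff,
    hlen, ← integral_const_mul, ← integral_add hint (hh.const_mul _)] at hle
  rw [hr']
  refine hle.trans_eq (integral_congr_ae (.of_forall fun s => ?_))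
  simp only
  ring

end Reparametrisation

/-! ### Measurability in time of functions of the velocity. -/

section Measurability

set_option linter.unusedSectionVars false

variable {E : Type*} [NormedAddCommGroup E] [NormedSpace ℝ E] [FiniteDimensional ℝ E]
  {M : Type*} [TopologicalSpace M] [ChartedSpace E M] [IsManifold 𝓘(ℝ, E) ∞ M]
  {F : Type*} [NormedAddCommGroup F] [NormedSpace ℝ F] [FiniteDimensional ℝ F]
  {D : M → Type*} [TopologicalSpace (TotalSpace F D)] [∀ x, NormedAddCommGroup (D x)]
  [∀ x, InnerProductSpace ℝ (D x)] [FiberBundle F D] [VectorBundle ℝ F D]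
  {𝒟 : Distribution E M F D} {γ : ℝ → M}

/-- The inclusion of a distribution in the tangent bundle, read in local trivialisations, is
continuous for the operator norm. -/
lemma Distribution.continuousOn_inclCoordinates (𝒟 : Distribution E M F D) (x₀ : M) :
    ContinuousOn (fun x => ((trivializationAt E (TangentSpace 𝓘(ℝ, E)) x₀).continuousLinearMapAt ℝ x
      ∘L 𝒟.incl x ∘L (trivializationAt F D x₀).symmL ℝ x : F →L[ℝ] E))
      ((trivializationAt F D x₀).baseSet ∩ (chartAt E x₀).source) := by
  set e := trivializationAt F D x₀
  set T := trivializationAt E (TangentSpace 𝓘(ℝ, E) : M → Type _) x₀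
  have hT : T.baseSet = (chartAt E x₀).source := TangentBundle.trivializationAt_baseSet x₀
  -- As `F` is finite-dimensional, operator-norm continuity may be checked vector by vector.
  rw [continuousOn_clm_apply]
  intro w
  have h1 : ContinuousOn (fun x : M => e.toOpenPartialHomeomorph.symm (x, w)) e.baseSet :=
    e.toOpenPartialHomeomorph.continuousOn_symm.comp
      (continuousOn_id.prodMk continuousOn_const) fun x hx => by
        rw [e.target_eq]; exact ⟨hx, mem_univ _⟩
  have h2 := 𝒟.contMDiff_incl.continuous.comp_continuousOn h1
  have h3 := (T.continuousOn.comp (h2.mono inter_subset_left) (t := T.source) fun x hx => by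
    rw [T.mem_source, hT]
    change (e.toOpenPartialHomeomorph.symm (x, w)).proj ∈ _
    rw [e.proj_symm_apply' hx.1]
    exact hx.2).snd
  refine h3.congr fun x hx => ?_
  have hx' : x ∈ T.baseSet := hT ▸ hx.2
  simp only [ContinuousLinearMap.comp_apply, Function.comp_apply]
  rw [← e.mk_symm hx.1, T.continuousLinearMapAt_apply ℝ, T.linearMapAt_apply, if_pos hx',
    Trivialization.symmL_apply (R := ℝ) e hx.1]

/-- Near every point, the fibre coordinate of a horizontal vector is a continuous linear function
of the coordinates of the vector in the tangent space. -/
lemma Distribution.exists_continuousOn_leftInverse (𝒟 : Distribution E M F D) (x₀ : M) :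
    ∃ U : Set M, IsOpen U ∧ x₀ ∈ U ∧
      U ⊆ (trivializationAt F D x₀).baseSet ∩ (chartAt E x₀).source ∧
      ∃ P : M → E →L[ℝ] F, ContinuousOn P U ∧ ∀ x ∈ U, ∀ v : D x,
        P x (mfderiv 𝓘(ℝ, E) 𝓘(ℝ, E) (extChartAt 𝓘(ℝ, E) x₀) x (𝒟.incl x v)) =
          (trivializationAt F D x₀ ⟨x, v⟩).2 := by
  have hA := 𝒟.continuousOn_inclCoordinates x₀
  set e := trivializationAt F D x₀
  set T := trivializationAt E (TangentSpace 𝓘(ℝ, E) : M → Type _) x₀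
  set A : M → F →L[ℝ] E := fun x => T.continuousLinearMapAt ℝ x ∘L 𝒟.incl x ∘L e.symmL ℝ x
  set V := e.baseSet ∩ (chartAt E x₀).source
  have hV : IsOpen V := e.open_baseSet.inter (chartAt E x₀).open_source
  have hT : T.baseSet = (chartAt E x₀).source := TangentBundle.trivializationAt_baseSet x₀
  have hx₀ : x₀ ∈ V := ⟨FiberBundle.mem_baseSet_trivializationAt' x₀, mem_chart_source E x₀⟩
  have hinj : Function.Injective (A x₀) := by
    have h1 : Function.Injective (T.continuousLinearMapAt ℝ x₀) :=
      Function.LeftInverse.injective (T.symmL_continuousLinearMapAt (hT ▸ hx₀.2))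
    have h2 : Function.Injective (e.symmL ℝ x₀) :=
      Function.LeftInverse.injective (e.continuousLinearMapAt_symmL hx₀.1)
    exact h1.comp ((𝒟.injective_incl x₀).comp h2)
  -- For a left inverse `B` of `A x₀`, the map `B ∘ A x` is the identity at `x₀`, hence invertible
  -- nearby; `P x = (B ∘ A x)⁻¹ ∘ B`.
  obtain ⟨B, hB⟩ := (A x₀ : F →ₗ[ℝ] E).exists_leftInverse_of_injective
    (LinearMap.ker_eq_bot.2 hinj)
  let B' : E →L[ℝ] F := B.toContinuousLinearMap
  have hBA : ContinuousOn (fun x => B' ∘L A x) V :=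
    ((ContinuousLinearMap.compL ℝ F E F B').continuous).comp_continuousOn hA
  have hunit : IsUnit (B' ∘L A x₀) := by
    have : B' ∘L A x₀ = 1 := by
      ext w
      exact DFunLike.congr_fun hB w
    rw [this]
    exact isUnit_one
  refine ⟨V ∩ (fun x => B' ∘L A x) ⁻¹' {u | IsUnit u}, hBA.isOpen_inter_preimage hV Units.isOpen,
    ⟨hx₀, hunit⟩, inter_subset_left, fun x => (Ring.inverse (B' ∘L A x) : F →L[ℝ] F) ∘L B',
    ?_, ?_⟩
  · intro x hx
    obtain ⟨u, hu⟩ := hx.2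
    have h1 : ContinuousWithinAt (fun x => Ring.inverse (B' ∘L A x))
        (V ∩ (fun x => B' ∘L A x) ⁻¹' {u | IsUnit u}) x := by
      refine ContinuousAt.comp_continuousWithinAt (g := Ring.inverse) ?_
        ((hBA x hx.1).mono inter_subset_left)
      change ContinuousAt Ring.inverse ((fun x => B' ∘L A x) x)
      rw [← hu]
      exact NormedRing.inverse_continuousAt u
    exact h1.clm_comp continuousWithinAt_const
  · rintro x ⟨hx, hu⟩ v
    have h1 : mfderiv 𝓘(ℝ, E) 𝓘(ℝ, E) (extChartAt 𝓘(ℝ, E) x₀) x (𝒟.incl x v) =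
        A x (e ⟨x, v⟩).2 := by
      have h2 : e.symmL ℝ x (e ⟨x, v⟩).2 = v := by
        have := Trivialization.symmL_continuousLinearMapAt (R := ℝ) e hx.1 v
        rwa [e.continuousLinearMapAt_apply ℝ, e.linearMapAt_apply, if_pos hx.1] at this
      simp only [A, ContinuousLinearMap.comp_apply]
      rw [h2, ← TangentBundle.continuousLinearMapAt_trivializationAt hx.2]
      rfl
    rw [h1]
    exact DFunLike.congr_fun (Ring.inverse_mul_cancel _ hu) _

lemma HasHorizontalVelocityAt.deriv_extChartAt {t : ℝ} {v : D (γ t)} {x₀ : M}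
    (hv : HasHorizontalVelocityAt 𝒟 γ t v) (ht : γ t ∈ (chartAt E x₀).source) :
    deriv (extChartAt 𝓘(ℝ, E) x₀ ∘ γ) t =
      mfderiv 𝓘(ℝ, E) 𝓘(ℝ, E) (extChartAt 𝓘(ℝ, E) x₀) (γ t) (𝒟.incl (γ t) v) := by
  have h := HasMFDerivAt.comp t
    (mdifferentiableAt_extChartAt (I := 𝓘(ℝ, E)) ht).hasMFDerivAt hv
  have key (f : ℝ → E) (B : E →L[ℝ] E) (w : E)
      (hf : HasFDerivAt f (B ∘L (1 : ℝ →L[ℝ] ℝ).smulRight w) t) : deriv f t = B w := by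
    simpa using hf.hasDerivAt.deriv
  exact key _ _ _ (hasMFDerivAt_iff_hasFDerivAt.1 h)

/-- Continuous functions are measurable along the (rescaled) velocity of a horizontal curve. -/
lemma IsHorizontal.aestronglyMeasurable {a b : ℝ} (hγ : IsHorizontal 𝒟 γ a b)
    {L : TotalSpace F D → ℝ} (hL : Continuous L) (r : ℝ) :
    AEStronglyMeasurable (fun t => L (fibreSmul r (velocity 𝒟 γ t)))
      (volume.restrict (Icc a b)) := by
  have hγc : ContinuousOn γ (Ioo a b) := ContinuousOn.mono hγ.1.1 Ioo_subset_Icc_self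
  have hloc : ∀ x₀ : M, ∃ U : Set M, IsOpen U ∧ x₀ ∈ U ∧
      AEStronglyMeasurable (fun t => L (fibreSmul r (velocity 𝒟 γ t)))
        (volume.restrict (Ioo a b ∩ γ ⁻¹' U)) := by
    intro x₀
    obtain ⟨U, hU, hx₀, hUV, P, hP, hPv⟩ := 𝒟.exists_continuousOn_leftInverse x₀
    refine ⟨U, hU, hx₀, ?_⟩
    set e := trivializationAt F D x₀
    set O := Ioo a b ∩ γ ⁻¹' U
    have hO : IsOpen O := hγc.isOpen_inter_preimage isOpen_Ioo hU
    borelize E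
    have : CompleteSpace E := FiniteDimensional.complete ℝ E
    have : ProperSpace E := FiniteDimensional.proper ℝ E
    -- `N` recovers the integrand from the time and the derivative of the chart expression of `γ`;
    -- that `deriv` is measurable for any function, and `N` is continuous over `O`.
    let N : ℝ × E → ℝ := fun p => L (e.toOpenPartialHomeomorph.symm (γ p.1, r • P (γ p.1) p.2))
    have hN : ContinuousOn N (O ×ˢ univ) := by
      have h1 : ContinuousOn (fun p : ℝ × E => γ p.1) (O ×ˢ univ) :=
        (hγc.mono inter_subset_left).comp continuousOn_fst fun p hp => hp.1
      have h2 : ContinuousOn (fun p : ℝ × E => P (γ p.1)) (O ×ˢ univ) :=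
        hP.comp h1 fun p hp => hp.1.2
      refine hL.comp_continuousOn (e.toOpenPartialHomeomorph.continuousOn_symm.comp
        (h1.prodMk ((h2.clm_apply continuousOn_snd).const_smul r)) fun p hp => ?_)
      rw [e.target_eq]
      exact ⟨(hUV hp.1.2).1, mem_univ _⟩
    classical
    have hNm : Measurable ((O ×ˢ (univ : Set E)).piecewise N 0) :=
      hN.measurable_piecewise continuousOn_const (hO.measurableSet.prod .univ)
    have hcomp := hNm.comp (measurable_id.prodMk
      (measurable_deriv (extChartAt 𝓘(ℝ, E) x₀ ∘ γ)))
    refine hcomp.aestronglyMeasurable.congr ?_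
    have hv := (ae_restrict_iff' measurableSet_Icc).1 hγ.2
    rw [Filter.EventuallyEq, ae_restrict_iff' hO.measurableSet]
    filter_upwards [hv] with t ht htO
    obtain ⟨v, hv⟩ := ht (Ioo_subset_Icc_self htO.1)
    have hb : γ t ∈ e.baseSet := (hUV htO.2).1
    rw [hv.velocity_eq, Function.comp_apply,
      piecewise_eq_of_mem _ _ _ (show (id t, _) ∈ O ×ˢ univ from ⟨htO, mem_univ _⟩)]
    simp only [N, id]
    rw [hv.deriv_extChartAt (hUV htO.2).2, hPv _ htO.2]
    congr 1
    have h1 : r • (e ⟨γ t, v⟩).2 = (e ⟨γ t, r • v⟩).2 :=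
      ((e.linear ℝ hb).map_smul r v).symm
    rw [h1]
    exact e.symm_apply_mk_proj (x := ⟨γ t, r • v⟩) (e.mem_source.2 hb)
  choose U hU hxU hm using hloc
  -- By the Lindelöf property, countably many of the local pieces cover the open interval.
  obtain ⟨s, -, hs, hcov⟩ := TopologicalSpace.countable_cover_nhdsWithin
    (f := fun t => Ioo a b ∩ γ ⁻¹' U (γ t)) (s := Ioo a b) fun t ht =>
      Filter.inter_mem self_mem_nhdsWithin (hγc t ht ((hU _).mem_nhds (hxU _)))
  have := hs.to_subtype
  have hm' : AEStronglyMeasurable (fun t => L (fibreSmul r (velocity 𝒟 γ t)))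
      (volume.restrict (⋃ t : s, Ioo a b ∩ γ ⁻¹' U (γ t))) := .iUnion fun t => hm _
  rw [← biUnion_eq_iUnion s (fun t _ => Ioo a b ∩ γ ⁻¹' U (γ t))] at hm'
  rw [← Measure.restrict_congr_set Ioo_ae_eq_Icc]
  exact hm'.mono_set hcov

end Measurability

/-! ### From minimality under time changes to constant energy. -/

section Energy

open scoped NNReal

set_option linter.unusedSectionVars false

variable {E : Type*} [NormedAddCommGroup E] [NormedSpace ℝ E] [FiniteDimensional ℝ E]
  {M : Type*} [TopologicalSpace M] [ChartedSpace E M] [IsManifold 𝓘(ℝ, E) ∞ M]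
  {F : Type*} [NormedAddCommGroup F] [NormedSpace ℝ F] [FiniteDimensional ℝ F]
  {D : M → Type*} [TopologicalSpace (TotalSpace F D)] [∀ x, NormedAddCommGroup (D x)]
  [∀ x, InnerProductSpace ℝ (D x)] [FiberBundle F D] [VectorBundle ℝ F D]
  {𝒟 : Distribution E M F D} {L : TotalSpace F D → ℝ} {γ : ℝ → M} {a b : ℝ}

/-- A differentiable function for which the rescaling `β ↦ β (f (v / β) + c)` is minimal at `β = 1`
among positive rational `β` has energy `c` at `v`. -/
lemma fderiv_apply_self_sub_eq {V : Type*} [NormedAddCommGroup V] [NormedSpace ℝ V] {f : V → ℝ}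
    (hf : Differentiable ℝ f) {v : V} {c : ℝ}
    (h : ∀ q : ℚ, 0 < q → f v + c ≤ (q : ℝ) * (f ((q : ℝ)⁻¹ • v) + c)) :
    fderiv ℝ f v v - f v = c := by
  let G : ℝ → ℝ := fun β => β * (f (β⁻¹ • v) + c)
  have hG : ∀ β : ℝ, 0 < β → ContinuousAt G β := fun β hβ =>
    continuousAt_id.mul (((hf.continuous.continuousAt).comp
      ((continuousAt_inv₀ hβ.ne').smul continuousAt_const)).add continuousAt_const)
  have hmin : ∀ β : ℝ, 0 < β → G 1 ≤ G β := by
    intro β hβ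
    have : (𝓝[range (Rat.cast : ℚ → ℝ)] β).NeBot :=
      mem_closure_iff_nhdsWithin_neBot.1 (Rat.denseRange_cast (𝕜 := ℝ) β)
    have hlim : Filter.Tendsto G (𝓝[range (Rat.cast : ℚ → ℝ)] β) (𝓝 (G β)) :=
      (hG β hβ).mono_left nhdsWithin_le_nhds
    refine ge_of_tendsto hlim ?_
    filter_upwards [self_mem_nhdsWithin, nhdsWithin_le_nhds (Ioi_mem_nhds hβ)] with x hx hx0
    obtain ⟨q, rfl⟩ := hx
    simpa [G] using h q (Rat.cast_pos.1 (mem_Ioi.1 hx0))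
  have hloc : IsLocalMin G 1 := by
    filter_upwards [Ioi_mem_nhds one_pos] with β hβ using hmin β hβ
  have h1 : HasDerivAt (fun β : ℝ => β⁻¹ • v) ((-1 : ℝ) • v) 1 := by
    simpa using (hasDerivAt_inv (one_ne_zero (α := ℝ))).smul_const v
  have h2 : HasFDerivAt f (fderiv ℝ f v) ((1 : ℝ)⁻¹ • v) := by
    rw [inv_one, one_smul]
    exact (hf v).hasFDerivAt
  have h3 : HasDerivAt G (1 * (f ((1 : ℝ)⁻¹ • v) + c) + 1 * fderiv ℝ f v ((-1 : ℝ) • v)) 1 :=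
    (hasDerivAt_id _).mul ((h2.comp_hasDerivAt _ h1).add_const c)
  have h4 := hloc.hasDerivAt_eq_zero h3
  simp only [inv_one, one_smul, neg_smul, map_neg] at h4
  linarith

/-- In a smooth trivialisation the fibre restriction of `L` is a `C¹` function on `F` composed with
a continuous linear equivalence. -/
lemma IsTonelli.differentiable_fibre [ContMDiffVectorBundle ∞ F D 𝓘(ℝ, E)]
    (hL : IsTonelli E L) (x : M) : Differentiable ℝ (fun u : D x => L ⟨x, u⟩) := by
  set e := trivializationAt F D x
  have hx : x ∈ e.baseSet := FiberBundle.mem_baseSet_trivializationAt' x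
  have h1 : ContMDiffOn (𝓘(ℝ, E).prod 𝓘(ℝ, F)) (𝓘(ℝ, E).prod 𝓘(ℝ, F)) 1
      e.toOpenPartialHomeomorph.symm e.target :=
    (e.contMDiffOn_symm (IB := 𝓘(ℝ, E)) (n := ∞)).of_le (by exact_mod_cast le_top)
  have h2 : ContMDiff 𝓘(ℝ, F) (𝓘(ℝ, E).prod 𝓘(ℝ, F)) 1
      (fun w : F => e.toOpenPartialHomeomorph.symm (x, w)) :=
    h1.comp_contMDiff (contMDiff_const.prodMk contMDiff_id) fun w => by
      rw [e.target_eq]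
      exact ⟨hx, mem_univ _⟩
  have h3 : ContMDiff 𝓘(ℝ, F) 𝓘(ℝ, ℝ) 1 (fun w : F => L (e.toOpenPartialHomeomorph.symm (x, w))) :=
    (hL.contMDiff.of_le (by norm_num)).comp h2
  have h4 := (contMDiff_iff_contDiff.1 h3).differentiable one_ne_zero
  have h5 := h4.comp (e.continuousLinearEquivAt ℝ x hx : D x →L[ℝ] F).differentiable
  have h6 : (fun u : D x => L ⟨x, u⟩) = (fun w : F => L (e.toOpenPartialHomeomorph.symm (x, w))) ∘
      (e.continuousLinearEquivAt ℝ x hx : D x →L[ℝ] F) := by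
    ext u
    have : e.toOpenPartialHomeomorph.symm (x, (e ⟨x, u⟩).2) = ⟨x, u⟩ :=
      e.symm_apply_mk_proj (x := ⟨x, u⟩) (e.mem_source.2 hx)
    exact congrArg L this.symm
  rw [h6]
  exact h5

lemma IsSemiStatic.integrableOn (hγ : IsSemiStatic 𝒟 L γ a b) :
    IntegrableOn (fun t => L (velocity 𝒟 γ t)) (Icc a b) := by
  obtain ⟨-, r, hr, -⟩ := hγ
  rw [action] at hr
  split_ifs at hr with hi
  · refine (hi.sub (integrable_const (criticalValue 𝒟 L))).congr (.of_forall fun t => ?_)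
    simp
  · exact absurd hr (EReal.top_ne_coe r)

/-- Along a semi-static curve, almost no velocity vector can be rescaled to lower the action. -/
lemma IsSemiStatic.ae_le (hγ : IsSemiStatic 𝒟 L γ a b) (hab : a < b) (hL : Continuous L)
    {C : ℝ} (hC : ∀ v, C ≤ L v) {β : ℝ} (hβ : 0 < β) :
    ∀ᵐ t ∂(volume.restrict (Icc a b)), L (velocity 𝒟 γ t) + criticalValue 𝒟 L ≤
      β * (L (fibreSmul β⁻¹ (velocity 𝒟 γ t)) + criticalValue 𝒟 L) := by
  set c := criticalValue 𝒟 L with hc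
  have hm := hγ.1.aestronglyMeasurable hL β⁻¹
  have hi := hγ.integrableOn
  set l := fun t => L (velocity 𝒟 γ t)
  set l' := fun t => L (fibreSmul β⁻¹ (velocity 𝒟 γ t))
  -- Strongly measurable representatives make the set `S` below genuinely measurable.
  obtain ⟨l₀, hl₀, hll₀⟩ := hi.aestronglyMeasurable
  obtain ⟨l₁, hl₁, hll₁⟩ := hm
  -- The truncation `l₀ ≤ n` makes the rescaled integrand bounded on the bad set: below by `C`,
  -- above by the defining inequality. Integrability of the rescaled Lagrangian is not known
  -- beforehand.
  have key (n : ℕ) : ∀ᵐ t ∂(volume.restrict (Icc a b)),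
      ¬ (l₀ t ≤ n ∧ β * (l₁ t + c) < l₀ t + c) := by
    let S : Set ℝ := {t | l₀ t ≤ n ∧ β * (l₁ t + c) < l₀ t + c}
    have hS : MeasurableSet S :=
      (measurableSet_le hl₀.measurable measurable_const).inter
        (measurableSet_lt ((hl₁.measurable.add_const c).const_mul β) (hl₀.measurable.add_const c))
    classical
    let h : ℝ → ℝ := S.piecewise (fun _ => β) (fun _ => 1)
    have hh : Measurable h := measurable_const.piecewise hS measurable_const
    have hmem : ∀ s, h s = β ∨ h s = 1 := fun s => by
      by_cases hs : s ∈ S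
      · exact .inl (piecewise_eq_of_mem _ _ _ hs)
      · exact .inr (piecewise_eq_of_notMem _ _ _ hs)
    let m : ℝ≥0 := ⟨min β 1, (lt_min hβ one_pos).le⟩
    let K : ℝ≥0 := ⟨max β 1, zero_le_one.trans (le_max_right _ _)⟩
    have hmh : ∀ s, m ≤ h s := fun s => by
      rcases hmem s with hs | hs <;> rw [hs]
      exacts [min_le_left _ _, min_le_right _ _]
    have hhK : ∀ s, h s ≤ K := fun s => by
      rcases hmem s with hs | hs <;> rw [hs]
      exacts [le_max_left _ _, le_max_right _ _]
    have hpos : ∀ s, 0 < h s := fun s => (lt_min hβ one_pos).trans_le (hmh s)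
    have hhi : IntegrableOn h (Icc a b) :=
      Measure.integrableOn_of_bounded (M := K) measure_Icc_lt_top.ne hh.aestronglyMeasurable
        (.of_forall fun s => by rw [Real.norm_of_nonneg (hpos s).le]; exact hhK s)
    obtain ⟨τ, hτa, hτ, hτ', hd⟩ := exists_orderIso_hasDerivAt hh (m := m) (K := K)
      (lt_min hβ one_pos) hmh hhK a
    have hbd : ∀ᵐ t ∂(volume.restrict (Icc a b)),
        ‖S.indicator (fun t => β * (l₁ t + c)) t‖ ≤ |β * (C + c)| + |n + c| := by
      filter_upwards [hll₁] with t ht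
      by_cases hs : t ∈ S
      · rw [indicator_of_mem hs, Real.norm_eq_abs]
        have h1 : β * (C + c) ≤ β * (l₁ t + c) := by
          have : C ≤ l₁ t := (hC _).trans_eq ht
          gcongr
        have h2 : β * (l₁ t + c) ≤ n + c := hs.2.le.trans (by linarith [hs.1])
        rw [abs_le]
        constructor
        · linarith [neg_abs_le (β * (C + c)), abs_nonneg (n + c)]
        · linarith [le_abs_self (n + c), abs_nonneg (β * (C + c))]
      · rw [indicator_of_notMem hs, norm_zero]
        positivity
    have hi₁ : IntegrableOn (S.indicator (fun t => β * (l₁ t + c))) (Icc a b) :=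
      Measure.integrableOn_of_bounded measure_Icc_lt_top.ne
        ((((hl₁.measurable.add_const c).const_mul β).indicator hS).aestronglyMeasurable) hbd
    have hi₀ : IntegrableOn (fun t => l₀ t + c) (Icc a b) :=
      (hi.congr hll₀).add (integrable_const c)
    let d : ℝ → ℝ := S.indicator (fun t => l₀ t + c - β * (l₁ t + c))
    have hdi : IntegrableOn d (Icc a b) := by
      refine ((hi₀.indicator hS).sub hi₁).congr (.of_forall fun t => ?_)
      exact (congrFun (indicator_sub S (fun t => l₀ t + c) fun t => β * (l₁ t + c)) t).symm
    have hcong : (fun s => h s * (L (fibreSmul (h s)⁻¹ (velocity 𝒟 γ s)) + c))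
        =ᵐ[volume.restrict (Icc a b)] fun t => (l₀ t + c) - d t := by
      filter_upwards [hll₀, hll₁] with t h0 h1
      by_cases hs : t ∈ S
      · simp only [h, d, piecewise_eq_of_mem _ _ _ hs, indicator_of_mem hs, ← h1, l']
        ring
      · simp only [h, d, piecewise_eq_of_notMem _ _ _ hs, indicator_of_notMem hs, ← h0, l]
        simp
    have hint : IntegrableOn (fun s => h s * (L (fibreSmul (h s)⁻¹ (velocity 𝒟 γ s)) + c))
        (Icc a b) := (hi₀.sub hdi).congr hcong.symm
    have hint' : IntegrableOn (fun s => h s * L (fibreSmul (h s)⁻¹ (velocity 𝒟 γ s)))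
        (Icc a b) := by
      refine (hint.sub (hhi.mul_const c)).congr (.of_forall fun s => ?_)
      simp only [Pi.sub_apply]
      ring
    have hle := hγ.integral_le hab hτ hτ' hτa hpos hd hhi hint'
    have hcong₀ : (fun t => L (velocity 𝒟 γ t) + c) =ᵐ[volume.restrict (Icc a b)]
        fun t => l₀ t + c := hll₀.add (.refl _ fun _ => c)
    rw [← hc, integral_congr_ae hcong, integral_sub hi₀ hdi, integral_congr_ae hcong₀] at hle
    -- `d` is the saving in action, positive exactly on `S`; `hle` says its integral is at most `0`,
    -- so `S` is null in `[a, b]`.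
    have hd0 : 0 ≤ d := indicator_nonneg fun t ht => sub_nonneg.2 ht.2.le
    have hzero : ∫ t in Icc a b, d t = 0 :=
      le_antisymm (by linarith) (integral_nonneg hd0)
    have hae := (integral_eq_zero_iff_of_nonneg hd0 hdi).1 hzero
    filter_upwards [hae] with t ht hs
    have : d t = l₀ t + c - β * (l₁ t + c) := indicator_of_mem (s := S) hs _
    rw [ht, Pi.zero_apply] at this
    linarith [hs.2]
  filter_upwards [ae_all_iff.2 key, hll₀, hll₁] with t ht h0 h1
  obtain ⟨n, hn⟩ := exists_nat_ge (l₀ t)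
  change l t + c ≤ β * (l' t + c)
  rw [h0, h1]
  exact not_lt.1 fun hlt => ht n ⟨hn, hlt⟩

lemma IsSemiStatic.ae_energy_eq [ContMDiffVectorBundle ∞ F D 𝓘(ℝ, E)]
    (hγ : IsSemiStatic 𝒟 L γ a b) (hab : a < b) (hL : IsTonelli E L) :
    ∀ᵐ t ∂(volume.restrict (Icc a b)), ∃ v : D (γ t), HasHorizontalVelocityAt 𝒟 γ t v ∧
      energy L ⟨γ t, v⟩ = criticalValue 𝒟 L := by
  -- Superlinearity with slope `0` is a global lower bound.
  obtain ⟨C, hC⟩ := hL.superlinear 0 le_rfl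
  have hC' : ∀ v, C ≤ L v := fun v => by simpa using hC v
  -- The null set depends on `β`; restricting to rationals gives one null set for all.
  have hmin : ∀ᵐ t ∂(volume.restrict (Icc a b)), ∀ q : ℚ, 0 < q →
      L (velocity 𝒟 γ t) + criticalValue 𝒟 L ≤
        (q : ℝ) * (L (fibreSmul (q : ℝ)⁻¹ (velocity 𝒟 γ t)) + criticalValue 𝒟 L) := by
    rw [ae_all_iff]
    intro q
    by_cases hq : 0 < q
    · filter_upwards [hγ.ae_le hab hL.contMDiff.continuous hC' (β := q) (by exact_mod_cast hq)]
        with t ht _ using ht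
    · exact .of_forall fun t h => absurd h hq
  filter_upwards [hmin, hγ.1.2] with t ht hv
  obtain ⟨v, hv⟩ := hv
  refine ⟨v, hv, ?_⟩
  rw [hv.velocity_eq] at ht
  exact fderiv_apply_self_sub_eq (hL.differentiable_fibre (γ t)) ht

end Energy

end SubRiemannian

end

theorem mainTheorem8
    {E : Type*} [NormedAddCommGroup E] [NormedSpace ℝ E] [FiniteDimensional ℝ E]
    {M : Type*} [TopologicalSpace M] [T2Space M] [CompactSpace M]
    [ChartedSpace E M] [IsManifold 𝓘(ℝ, E) ∞ M]
    {F : Type*} [NormedAddCommGroup F] [NormedSpace ℝ F] [FiniteDimensional ℝ F]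
    {D : M → Type*} [TopologicalSpace (TotalSpace F D)] [∀ x, NormedAddCommGroup (D x)]
    [∀ x, InnerProductSpace ℝ (D x)] [FiberBundle F D] [VectorBundle ℝ F D]
    [ContMDiffVectorBundle ∞ F D 𝓘(ℝ, E)] [IsContMDiffRiemannianBundle 𝓘(ℝ, E) ∞ F D]
    (𝒟 : SubRiemannian.Distribution E M F D) (h𝒟 : SubRiemannian.IsBracketGenerating 𝒟)
    (L : TotalSpace F D → ℝ) (hL : SubRiemannian.IsTonelli E L) :
    (∀ (a b : ℝ) (η : ℝ → M), a < b → SubRiemannian.IsSemiStatic 𝒟 L η a b →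
      ∀ᵐ t ∂(volume.restrict (Icc a b)),
        ∃ v : D (η t), SubRiemannian.HasHorizontalVelocityAt 𝒟 η t v ∧
          SubRiemannian.energy L ⟨η t, v⟩ = SubRiemannian.criticalValue 𝒟 L) ∧
    (∀ (J : Set ℝ) (η : ℝ → M), J.OrdConnected → SubRiemannian.IsSemiStaticOn 𝒟 L η J →
      ∀ᵐ t ∂(volume.restrict J),
        ∃ v : D (η t), SubRiemannian.HasHorizontalVelocityAt 𝒟 η t v ∧
          SubRiemannian.energy L ⟨η t, v⟩ = SubRiemannian.criticalValue 𝒟 L) := by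
  refine ⟨fun a b η hab hη => hη.ae_energy_eq hab hL, fun J η _ hη => ?_⟩
  -- Reduces an arbitrary `J` to intervals with endpoints in `J`, where the compact case applies.
  refine ae_restrict_of_ae_restrict_inter_Ioo fun a b ha hb hab => ?_
  exact ae_restrict_of_ae_restrict_of_subset (inter_subset_right.trans Ioo_subset_Icc_self)
    ((hη a ha b hb hab).ae_energy_eq hab hL)
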